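/- For $n \ge 0$ let $S_n^{\pm}$ denote the signed permutation (hyperoctahedral) group, i.e. the group of all permutations $\pi$ of the set $\{-n,\dots,-1,1,\dots,n\}$ such that $\pi(-x)=-\pi(x)$ for all $x$. For $n\ge 1$ regard $S_{n-1}^{\pm}$ as a subgroup of $S_n^{\pm}$ by extending a signed permutation of $\{\pm1,\dots,\pm(n-1)\}$ by the identity on $\pm n$. Then the signed permutation groups satisfy homological stability: for all integers $r\ge 0$ and $n>2r$, the inclusion-induced map on integral group homology (with trivial coefficients $\mathbb Z$) $$H_r(S_{n-1}^{\pm};\mathbb Z)\to H_r(S_n^{\pm};\mathbb Z)$$ is an isomorphism. -/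

import Mathlib

/-- The set `{-n, …, -1, 1, …, n}` of nonzero integers of absolute value at most `n`. -/
def SignedSet (n : ℕ) : Type := {x : ℤ // x ≠ 0 ∧ |x| ≤ (n : ℤ)}

namespace SignedSet

instance (n : ℕ) : Neg (SignedSet n) :=
  ⟨fun x => ⟨-x.1, neg_ne_zero.mpr x.2.1, by rw [abs_neg]; exact x.2.2⟩⟩

/-- The inclusion `{±1, …, ±m} ⊆ {±1, …, ±n}` for `m ≤ n`. -/
def incl {m n : ℕ} (h : m ≤ n) : SignedSet m ↪ SignedSet n where
  toFun x := ⟨x.1, x.2.1, x.2.2.trans (by exact_mod_cast h)⟩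
  inj' x y hxy := Subtype.ext (congrArg (fun z : SignedSet n => z.1) hxy)

theorem neg_neg' {n : ℕ} (x : SignedSet n) : - -x = x :=
  Subtype.ext (neg_neg x.1)

theorem incl_neg {m n : ℕ} (h : m ≤ n) (x : SignedSet m) : incl h (-x) = -incl h x := rfl

end SignedSet

/-- The signed permutation (hyperoctahedral) group: the permutations `π` of `{±1, …, ±n}` with
`π (-x) = -π x` for all `x`. -/
def SignedPerm (n : ℕ) : Subgroup (Equiv.Perm (SignedSet n)) where
  carrier := {π | ∀ x, π (-x) = -π x}
  mul_mem' {a b} ha hb x := by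
    change a (b (-x)) = -a (b x)
    rw [hb x, ha (b x)]
  one_mem' _ := rfl
  inv_mem' {a} ha x := by
    apply a.injective
    rw [ha (a⁻¹ x)]
    exact (a.apply_symm_apply (-x)).trans (congrArg _ (a.apply_symm_apply x).symm)

namespace SignedPerm

theorem viaEmbedding_mem {m n : ℕ} (h : m ≤ n) (π : SignedPerm m) :
    Equiv.Perm.viaEmbeddingHom (SignedSet.incl h) π.1 ∈ SignedPerm n := by
  intro x
  rw [Equiv.Perm.viaEmbeddingHom_apply]
  by_cases hx : x ∈ Set.range (SignedSet.incl h)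
  · obtain ⟨y, rfl⟩ := hx
    rw [← SignedSet.incl_neg, Equiv.Perm.viaEmbedding_apply, Equiv.Perm.viaEmbedding_apply,
      π.2 y, SignedSet.incl_neg]
  · have hx' : -x ∉ Set.range (SignedSet.incl h) := by
      rintro ⟨y, hy⟩
      exact hx ⟨-y, by rw [SignedSet.incl_neg, hy, SignedSet.neg_neg']⟩
    rw [Equiv.Perm.viaEmbedding_apply_of_notMem _ _ _ hx,
      Equiv.Perm.viaEmbedding_apply_of_notMem _ _ _ hx']

/-- The standard inclusion of signed permutation groups for `m ≤ n`: a signed permutation of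
`{±1, …, ±m}` is extended to `{±1, …, ±n}` by the identity. -/
noncomputable def incl {m n : ℕ} (h : m ≤ n) : SignedPerm m →* SignedPerm n :=
  ((Equiv.Perm.viaEmbeddingHom (SignedSet.incl h)).comp (SignedPerm m).subtype).codRestrict
    (SignedPerm n) (viaEmbedding_mem h)

end SignedPerm

/-- Integral group homology `H_r(G) = H_r(G; ℤ)`, with `ℤ` the trivial `G`-module. -/
noncomputable abbrev integralHomology (G : Type) [Group G] (r : ℕ) : ModuleCat ℤ :=
  groupHomology (Rep.trivial ℤ G ℤ) r

/-- The map `H_r(G; ℤ) ⟶ H_r(H; ℤ)` induced by a group homomorphism `f : G →* H` and the identity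
of the trivial module `ℤ`. -/
noncomputable abbrev integralHomologyMap {G H : Type} [Group G] [Group H] (f : G →* H) (r : ℕ) :
    integralHomology G r ⟶ integralHomology H r :=
  groupHomology.map (A := Rep.trivial ℤ G ℤ) (B := Rep.trivial ℤ H ℤ) f
    (CategoryTheory.CategoryStruct.id (Rep.trivial ℤ G ℤ)) r

/-!
Let `C` be the augmented complex of `S_n^±`-modules whose degree `l` part is spanned by the words of
length `l` in `±1, …, ±n` with distinct absolute values, the differential being the alternating sum
of the deletions of a letter. It is exact below degree `n`: fixing a letter `e`, a cycle can be
modified by boundaries until neither `e` nor `-e` occurs in it (their occurrences are pushed towards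
the first position and then out of the word, one position at a time), and then prefixing `e` bounds
it.

The stabilizer of a word of length `l` is conjugate to `S_{n-l}^±`, so Shapiro's lemma identifies
`H_q(S_n^±; C_l)` with `H_q(S_{n-l}^±)`. As inner automorphisms act trivially on homology, each of
the `l + 1` deletions `C_{l+1} → C_l` induces the stabilization map
`H_q(S_{n-l-1}^±) → H_q(S_{n-l}^±)`; hence the differential induces that map for `l` even and `0`
for `l` odd. By induction on `q` the long exact sequences of `0 → Z_{i+1} → C_{i+1} → Z_i → 0`,
where `Z` denotes the cycles, then show that `C_1 → C_0` induces an isomorphism on `H_r`.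
-/

section RelativeProjectivity

open CategoryTheory Limits Finsupp

universe u

theorem contractNth_zero_cons {G : Type*} {n : ℕ} (op : G → G → G) (a : G) (g : Fin (n + 1) → G) :
    Fin.contractNth 0 op (Fin.cons a g : Fin (n + 2) → G) =
      Fin.cons (op a (g 0)) fun i : Fin n => g i.succ := by
  ext i
  refine Fin.cases ?_ (fun i => ?_) i
  · rw [Fin.contractNth_apply_of_eq _ _ _ _ (by simp)]
    simp
  · rw [Fin.contractNth_apply_of_gt _ _ _ _ (by simp)]
    simp

theorem contractNth_succ_cons {G : Type*} {n : ℕ} (op : G → G → G) (j : Fin (n + 1)) (a : G)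
    (g : Fin (n + 1) → G) :
    Fin.contractNth j.succ op (Fin.cons a g : Fin (n + 2) → G) =
      Fin.cons a (Fin.contractNth j op g) := by
  ext i
  refine Fin.cases ?_ (fun i => ?_) i
  · rw [Fin.contractNth_apply_of_lt _ _ _ _ (by simp)]
    simp
  · rcases lt_trichotomy (i : ℕ) j with h | h | h
    · rw [Fin.contractNth_apply_of_lt _ _ _ _ (by simpa using h), Fin.cons_succ,
        Fin.contractNth_apply_of_lt _ _ _ _ h, ← Fin.succ_castSucc, Fin.cons_succ]
    · rw [Fin.contractNth_apply_of_eq _ _ _ _ (by simpa using h), Fin.cons_succ, Fin.cons_succ,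
        Fin.contractNth_apply_of_eq _ _ _ _ h, ← Fin.succ_castSucc, Fin.cons_succ]
    · rw [Fin.contractNth_apply_of_gt _ _ _ _ (by simpa using h), Fin.cons_succ, Fin.cons_succ,
        Fin.contractNth_apply_of_gt _ _ _ _ h]

variable {k G S : Type u} [CommRing k] [Group G] [Group S]

/-- The representation `G →₀ A` with `G` acting by left translation only. -/
noncomputable abbrev freeCover (A : Rep.{u} k G) : Rep.{u} k G :=
  Rep.of (X := G →₀ A)
    { toFun g := lmapDomain A k (g * ·)
      map_one' := by ext; simp
      map_mul' g h := by ext; simp [mul_assoc] }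

/-- The action map `G →₀ A ⟶ A`, whose kernel is used for dimension shifting. -/
noncomputable abbrev freeCoverπ (A : Rep.{u} k G) : freeCover A ⟶ A :=
  Rep.ofHom ⟨lsum (R := k) k fun g => A.ρ g, fun g => by ext; simp⟩

instance epi_freeCoverπ (A : Rep.{u} k G) : Epi (freeCoverπ A) :=
  (Rep.epi_iff_surjective _).2 fun a => ⟨single 1 a, by simp⟩

/-- A representation is *relatively projective* if it is a direct summand of a representation
induced from the trivial subgroup; by Frobenius reciprocity the action map is then split. -/
def IsRelativelyProjective (A : Rep.{u} k G) : Prop :=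
  IsSplitEpi (freeCoverπ A)

theorem isRelativelyProjective_freeCover (A : Rep.{u} k G) :
    IsRelativelyProjective (freeCover A) := by
  let σ : freeCover A ⟶ freeCover (freeCover A) :=
    Rep.ofHom ⟨lsum (R := k) k fun g => lsingle g ∘ₗ lsingle 1, fun g => by ext; simp⟩
  exact ⟨⟨σ, by ext : 2; refine lhom_ext fun g a => ?_; simp [σ]⟩⟩

section Vanishing

variable {A : Rep.{u} k G}

/-- The prism operator prefixing the bar `g` with the inverse of the group element. -/
noncomputable def barCons {n : ℕ} (g : Fin n → G) :
    (G →₀ A) →ₗ[k] ((Fin (n + 1) → G) →₀ A) :=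
  lmapDomain A k fun x => Fin.cons x⁻¹ g

theorem barCons_single {n : ℕ} (g : Fin n → G) (x : G) (a : A) :
    barCons (k := k) g (single x a) = single (Fin.cons x⁻¹ g) a := by
  simp [barCons]

theorem d_barCons {n : ℕ} (g : Fin (n + 1) → G) (v : freeCover A) :
    groupHomology.inhomogeneousChains.d A (n + 1) (barCons g v) +
        (barCons (fun i => g i.succ) ((freeCover A).ρ (g 0)⁻¹ v) +
          ∑ j : Fin (n + 1), (-1 : k) ^ ((j : ℕ) + 1) • barCons (j.contractNth (· * ·) g) v) =
      single g ((freeCoverπ A).hom v) := by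
  induction v using Finsupp.induction_linear with
  | zero => simp
  | add v w hv hw =>
    simp only [map_add, ← hv, ← hw, single_add, smul_add, Finset.sum_add_distrib]
    abel
  | single x a =>
    simp only [barCons_single, groupHomology.inhomogeneousChains.d_single (G := G),
      Fin.sum_univ_succ (n := n + 1), Fin.cons_succ, Fin.cons_zero, contractNth_zero_cons,
      contractNth_succ_cons]
    simp [barCons_single, pow_succ]
    abel

theorem exists_d_eq_of_isRelativelyProjective (hA : IsRelativelyProjective A) {n : ℕ}
    {z : (Fin (n + 1) → G) →₀ A}
    (hz : groupHomology.inhomogeneousChains.d A n z = 0) :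
    ∃ y, groupHomology.inhomogeneousChains.d A (n + 1) y = z := by
  obtain ⟨⟨σ, hσ⟩⟩ := hA
  have hσ' (a : A) : (freeCoverπ A).hom (σ.hom a) = a :=
    congrArg (fun φ : A ⟶ A => φ.hom a) hσ
  let s (m : ℕ) : ((Fin m → G) →₀ A) →ₗ[k] ((Fin (m + 1) → G) →₀ A) :=
    lsum (R := k) k fun g => barCons g ∘ₗ σ.hom.toLinearMap
  have hs {m : ℕ} (g : Fin m → G) (a : A) : s m (single g a) = barCons g (σ.hom a) := by
    simp [s]
  have homotopy : (groupHomology.inhomogeneousChains.d A (n + 1)).hom ∘ₗ s (n + 1) +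
      s n ∘ₗ (groupHomology.inhomogeneousChains.d A n).hom = LinearMap.id := by
    refine lhom_ext fun g a => ?_
    simp only [LinearMap.add_apply, LinearMap.comp_apply, LinearMap.id_apply, hs,
      groupHomology.inhomogeneousChains.d_single (G := G), map_sum, map_add, map_smul,
      Rep.hom_comm_apply σ]
    exact (d_barCons g (σ.hom a)).trans (congrArg (single g) (hσ' a))
  refine ⟨s (n + 1) z, ?_⟩
  simpa [hz] using LinearMap.congr_fun homotopy z

theorem isZero_groupHomology_of_isRelativelyProjective (hA : IsRelativelyProjective A) (n : ℕ) :
    IsZero (groupHomology A (n + 1)) := by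
  refine ((groupHomology.inhomogeneousChains A).exactAt_iff_isZero_homology _).1 ?_
  rw [HomologicalComplex.exactAt_iff' _ (n + 2) (n + 1) n (by simp) (by simp),
    ShortComplex.moduleCat_exact_iff]
  intro z hz
  obtain ⟨y, hy⟩ := exists_d_eq_of_isRelativelyProjective hA (z := z) (by
    rw [← groupHomology.inhomogeneousChains.d_def]; exact hz)
  refine ⟨y, ?_⟩
  rw [← hy, ← groupHomology.inhomogeneousChains.d_def]
  rfl

end Vanishing

theorem isRelativelyProjective_res {A : Rep.{u} k G} (hA : IsRelativelyProjective A) {f : S →* G}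
    (hf : Function.Injective f) : IsRelativelyProjective (Rep.res f A) := by
  obtain ⟨⟨σ, hσ⟩⟩ := hA
  obtain ⟨T, hT, -⟩ := f.range.exists_isComplement_right 1
  let r (x : G) : S := (f.ofInjective hf).symm (hT.equiv x).1
  have hr (s : S) (x : G) : r (f s * x) = s * r x := by
    have hmul := congrArg Prod.fst (hT.equiv_mul_left (f.ofInjective hf s) x)
    refine (f.ofInjective hf).injective ?_
    rw [map_mul, MulEquiv.apply_symm_apply, MulEquiv.apply_symm_apply]
    exact hmul
  let τ : Rep.res f (freeCover A) ⟶ freeCover (Rep.res f A) :=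
    Rep.ofHom ⟨lsum (R := k) k fun x => lsingle (r x) ∘ₗ A.ρ ((f (r x))⁻¹ * x),
      fun s => by ext; simp [hr, mul_assoc]⟩
  have hτ : τ ≫ freeCoverπ (Rep.res f A) = (Rep.resFunctor f).map (freeCoverπ A) := by
    ext : 2
    refine lhom_ext fun x a => ?_
    simp [τ]
  exact ⟨⟨(Rep.resFunctor f).map σ ≫ τ, by
    rw [Category.assoc, hτ, ← Functor.map_comp, hσ, CategoryTheory.Functor.map_id]⟩⟩

/-- The representation `X →₀ A` with `G` acting diagonally on the `G`-set `X` and on `A`. -/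
noncomputable abbrev permTensor (X : Type u) [MulAction G X] (A : Rep.{u} k G) : Rep.{u} k G :=
  Rep.of (X := X →₀ A)
    { toFun g := mapRange.linearMap (A.ρ g) ∘ₗ lmapDomain A k (g • ·)
      map_one' := by ext; simp
      map_mul' g h := by ext; simp [mul_smul] }

theorem permTensor_ρ_single {X : Type u} [MulAction G X] (A : Rep.{u} k G) (g : G) (x : X) (a : A) :
    (permTensor X A).ρ g (single x a) = single (g • x) (A.ρ g a) := by
  simp

/-- The functor `A ↦ (X →₀ A)` of tensoring with the permutation representation of `X`. -/
noncomputable abbrev permTensorFunctor (k : Type u) [CommRing k] (X : Type u) [MulAction G X] :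
    Rep.{u} k G ⥤ Rep.{u} k G where
  obj A := permTensor X A
  map φ := Rep.ofHom ⟨mapRange.linearMap φ.hom.toLinearMap, fun g => by
    ext; simp [Rep.hom_comm_apply]⟩
  map_id A := by ext : 2; refine lhom_ext fun x a => ?_; simp
  map_comp φ ψ := by ext : 2; refine lhom_ext fun x a => ?_; simp

instance permTensorFunctor_preservesZeroMorphisms (X : Type u) [MulAction G X] :
    (permTensorFunctor (G := G) k X).PreservesZeroMorphisms where
  map_zero A B := by
    ext : 2
    exact lhom_ext fun x _ => (mapRange_single (hf := rfl)).trans (single_zero x)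

theorem isRelativelyProjective_permTensor {A : Rep.{u} k G} (hA : IsRelativelyProjective A)
    (X : Type u) [MulAction G X] : IsRelativelyProjective (permTensor X A) := by
  obtain ⟨⟨σ, hσ⟩⟩ := hA
  let t : (X →₀ (G →₀ A)) →ₗ[k] (G →₀ (X →₀ A)) :=
    lsum (R := k) k fun x => lsum (R := k) k fun g => lsingle g ∘ₗ lsingle (g⁻¹ • x)
  have ht (x : X) (g : G) (a : A) :
      t (single x (single g a)) = single g (single (g⁻¹ • x) a) := by
    simp only [t, lsum_single, LinearMap.comp_apply, lsingle_apply]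
  let τ : permTensor X (freeCover A) ⟶ freeCover (permTensor X A) :=
    Rep.ofHom ⟨t, fun g => by ext x h a : 4; simp [ht, mul_smul]⟩
  have hτ : τ ≫ freeCoverπ (permTensor X A) = (permTensorFunctor k X).map (freeCoverπ A) := by
    ext x g a : 6
    simp [τ, ht]
  exact ⟨⟨(permTensorFunctor k X).map σ ≫ τ, by
    rw [Category.assoc, hτ, ← Functor.map_comp, hσ, CategoryTheory.Functor.map_id]⟩⟩

end RelativeProjectivity

section Shapiro

open CategoryTheory Limits Finsupp groupHomology

universe u

theorem isIso_τ₁_of_isIso_τ₂_of_mono_τ₃ {C : Type*} [Category* C] [Abelian C]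
    {S T : ShortComplex C} (φ : S ⟶ T) (hS : S.Exact) [Mono S.f] [Mono T.f] [IsIso φ.τ₂]
    [Mono φ.τ₃] : IsIso φ.τ₁ := by
  have hzero : (T.f ≫ inv φ.τ₂) ≫ S.g = 0 := by
    rw [← cancel_mono φ.τ₃, Category.assoc, Category.assoc, ← φ.comm₂₃, IsIso.inv_hom_id_assoc,
      T.zero, zero_comp]
  have : Mono φ.τ₁ := by
    have : Mono (φ.τ₁ ≫ T.f) := by rw [φ.comm₁₂]; infer_instance
    exact mono_of_mono φ.τ₁ T.f
  have : IsSplitEpi φ.τ₁ := ⟨⟨hS.lift _ hzero, by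
    rw [← cancel_mono T.f, Category.assoc, φ.comm₁₂, ← Category.assoc, hS.lift_f, Category.assoc,
      IsIso.inv_hom_id, Category.comp_id, Category.id_comp]⟩⟩
  exact isIso_of_mono_of_epi _

variable {k G S : Type u} [CommRing k] [Group G] [Group S]

/-- The short complex `ker ⟶ (G →₀ A) ⟶ A`. -/
noncomputable abbrev freeCoverShortComplex (A : Rep.{u} k G) : ShortComplex (Rep.{u} k G) :=
  ShortComplex.mk (kernel.ι (freeCoverπ A)) (freeCoverπ A) (kernel.condition _)

theorem shortExact_freeCoverShortComplex (A : Rep.{u} k G) :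
    (freeCoverShortComplex A).ShortExact where
  exact := ShortComplex.exact_of_f_is_kernel _ (kernelIsKernel _)
  mono_f := inferInstance
  epi_g := inferInstance

theorem exact_iff_function_exact (T : ShortComplex (Rep.{u} k G)) :
    T.Exact ↔ Function.Exact T.f.hom T.g.hom := by
  rw [← ShortComplex.exact_map_iff_of_faithful T (forget₂ (Rep.{u} k G) (ModuleCat.{u} k)),
    ShortComplex.ShortExact.moduleCat_exact_iff_function_exact]
  rfl

theorem shortExact_iff_function_exact (T : ShortComplex (Rep.{u} k G)) :
    T.ShortExact ↔ Function.Injective T.f.hom ∧ Function.Surjective T.g.hom ∧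
      Function.Exact T.f.hom T.g.hom := by
  rw [← Rep.mono_iff_injective, ← Rep.epi_iff_surjective, ← exact_iff_function_exact]
  exact ⟨fun h => ⟨h.2, h.3, h.1⟩, fun h => @ShortComplex.ShortExact.mk _ _ _ _ h.2.2 h.1 h.2.1⟩

theorem shortExact_map_permTensorFunctor (X : Type u) [MulAction G X]
    {T : ShortComplex (Rep.{u} k G)} (hT : T.ShortExact) :
    (T.map (permTensorFunctor k X)).ShortExact := by
  rw [shortExact_iff_function_exact] at hT ⊢
  obtain ⟨hinj, hsurj, hexact⟩ := hT
  refine ⟨mapRange_injective _ (map_zero _) hinj, mapRange_surjective _ (map_zero _) hsurj, ?_⟩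
  have hker : LinearMap.ker T.g.hom.toLinearMap = LinearMap.range T.f.hom.toLinearMap :=
    LinearMap.exact_iff.1 hexact
  change Function.Exact (mapRange.linearMap T.f.hom.toLinearMap)
    (mapRange.linearMap T.g.hom.toLinearMap)
  rw [LinearMap.exact_iff, ker_mapRange,
    range_mapRange_linearMap _ (LinearMap.ker_eq_bot.2 hinj), hker]

section Naturality

variable {f : S →* G}

theorem chainsMap_naturality {A A' : Rep.{u} k S} {B B' : Rep.{u} k G} {φ : A ⟶ Rep.res f B}
    {φ' : A' ⟶ Rep.res f B'} {a : A ⟶ A'} {b : B ⟶ B'}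
    (h : φ ≫ (Rep.resFunctor f).map b = a ≫ φ') :
    chainsMap f φ ≫ chainsMap (MonoidHom.id G) b =
      chainsMap (MonoidHom.id S) a ≫ chainsMap f φ' := by
  rw [← chainsMap_comp, ← chainsMap_comp (MonoidHom.id S) f a φ']
  exact chainsMap_congr rfl (congrArg (fun ψ : A ⟶ Rep.res f B' => ψ.hom.toLinearMap) h)

theorem map_naturality {A A' : Rep.{u} k S} {B B' : Rep.{u} k G} {φ : A ⟶ Rep.res f B}
    {φ' : A' ⟶ Rep.res f B'} {a : A ⟶ A'} {b : B ⟶ B'}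
    (h : φ ≫ (Rep.resFunctor f).map b = a ≫ φ') (n : ℕ) :
    map f φ n ≫ map (MonoidHom.id G) b n = map (MonoidHom.id S) a n ≫ map f φ' n := by
  have := congrArg (HomologicalComplex.homologyMap · n) (chainsMap_naturality h)
  rwa [HomologicalComplex.homologyMap_comp, HomologicalComplex.homologyMap_comp] at this

variable {X : ShortComplex (Rep.{u} k S)} {Y : ShortComplex (Rep.{u} k G)}

theorem δ_naturality (hX : X.ShortExact) (hY : Y.ShortExact) (φ : X ⟶ Y.map (Rep.resFunctor f))
    (n : ℕ) :
    δ hX (n + 1) n rfl ≫ map f φ.τ₁ n = map f φ.τ₃ (n + 1) ≫ δ hY (n + 1) n rfl :=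
  HomologicalComplex.HomologySequence.δ_naturality
    (S₁ := X.map (chainsFunctor k S)) (S₂ := Y.map (chainsFunctor k G))
    { τ₁ := chainsMap f φ.τ₁
      τ₂ := chainsMap f φ.τ₂
      τ₃ := chainsMap f φ.τ₃
      comm₁₂ := chainsMap_naturality φ.comm₁₂
      comm₂₃ := chainsMap_naturality φ.comm₂₃ }
    (map_chainsFunctor_shortExact hX) (map_chainsFunctor_shortExact hY) (n + 1) n rfl

theorem isIso_map_succ_of_isZero (hX : X.ShortExact) (hY : Y.ShortExact)
    (φ : X ⟶ Y.map (Rep.resFunctor f)) (n : ℕ) (hX₂ : IsZero (groupHomology X.X₂ (n + 1)))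
    (hY₂ : IsZero (groupHomology Y.X₂ (n + 1))) (h₁ : IsIso (map f φ.τ₁ n))
    (h₂ : IsIso (map f φ.τ₂ n)) : IsIso (map f φ.τ₃ (n + 1)) := by
  let ψ : mapShortComplex₁ hX (i := n + 1) rfl ⟶ mapShortComplex₁ hY (i := n + 1) rfl :=
    { τ₁ := map f φ.τ₃ (n + 1)
      τ₂ := map f φ.τ₁ n
      τ₃ := map f φ.τ₂ n
      comm₁₂ := (δ_naturality hX hY φ n).symm
      comm₂₃ := map_naturality φ.comm₁₂ n }
  have : Mono (mapShortComplex₁ hX (i := n + 1) rfl).f := mono_δ_of_isZero hX n hX₂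
  have : Mono (mapShortComplex₁ hY (i := n + 1) rfl).f := mono_δ_of_isZero hY n hY₂
  have : IsIso ψ.τ₂ := h₁
  have : Mono ψ.τ₃ := inferInstanceAs (Mono (map f φ.τ₂ n))
  exact isIso_τ₁_of_isIso_τ₂_of_mono_τ₃ ψ (mapShortComplex₁_exact hX (i := n + 1) rfl)

end Naturality

theorem H0π_ρ_apply (A : Rep.{u} k G) (g : G) (a : A) : H0π A (A.ρ g a) = H0π A a := by
  rw [← coinvariantsMk_comp_H0Iso_inv]
  exact congrArg (H0Iso A).inv (Representation.Coinvariants.mk_self_apply A.ρ g a)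

/-- The linear map out of `H₀(G; A)` induced by a `G`-invariant linear map out of `A`. -/
noncomputable def H0Desc (A : Rep.{u} k G) {M : ModuleCat.{u} k} (l : A.V →ₗ[k] M)
    (hl : ∀ g, l ∘ₗ A.ρ g = l) : groupHomology A 0 ⟶ M :=
  (H0Iso A).hom ≫ ModuleCat.ofHom (Representation.Coinvariants.lift A.ρ l hl)

theorem H0π_comp_H0Desc (A : Rep.{u} k G) {M : ModuleCat.{u} k} (l : A.V →ₗ[k] M)
    (hl : ∀ g, l ∘ₗ A.ρ g = l) : H0π A ≫ H0Desc A l hl = ModuleCat.ofHom l := by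
  rw [H0Desc, H0π_comp_H0Iso_hom_assoc]
  rfl

/-- The action of `g` on representations, as a natural transformation covering conjugation
by `g`. -/
noncomputable def conjHom (k : Type u) [CommRing k] (g : G) :
    𝟭 (Rep.{u} k G) ⟶ Rep.resFunctor (MulAut.conj g).toMonoidHom where
  app A := Rep.ofHom ⟨A.ρ g, fun h => by ext; simp⟩
  naturality A B φ := by ext a; exact (Rep.hom_comm_apply φ g a).symm

theorem map_conjHom (g : G) (n : ℕ) (A : Rep.{u} k G) :
    map (MulAut.conj g).toMonoidHom ((conjHom k g).app A) n = 𝟙 (groupHomology A n) := by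
  induction n generalizing A with
  | zero =>
    rw [← cancel_epi (H0π A), H0π_comp_map]
    ext a
    exact H0π_ρ_apply A g a
  | succ n ih =>
    have hA := shortExact_freeCoverShortComplex A
    have := mono_δ_of_isZero hA n
      (isZero_groupHomology_of_isRelativelyProjective (isRelativelyProjective_freeCover A) n)
    rw [← cancel_mono (δ hA (n + 1) n rfl)]
    have hδ := δ_naturality hA hA ((freeCoverShortComplex A).mapNatTrans (conjHom k g)) n
    rw [ShortComplex.mapNatTrans_τ₁, ShortComplex.mapNatTrans_τ₃, ih] at hδ
    simpa using hδ.symm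

variable {X : Type u} [MulAction G X] (f : S →* G) (w : X)

/-- The morphisms `A ⟶ (X →₀ A)` sending `a` to `single w a`, where `w` is fixed by `S`. -/
noncomputable def permTensorSingle (k : Type u) [CommRing k] (hw : ∀ s, f s • w = w) :
    Rep.resFunctor f ⟶ permTensorFunctor k X ⋙ Rep.resFunctor f where
  app A := Rep.ofHom ⟨lsingle w, fun s => by ext; simp [hw]⟩
  naturality A B φ := by ext a; exact (mapRange_single (hf := map_zero φ.hom)).symm

theorem isIso_map_permTensorSingle_zero (hw : ∀ s, f s • w = w)
    (hrange : ∀ g : G, g • w = w → g ∈ f.range) (htrans : ∀ x : X, ∃ g : G, g • w = x)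
    (A : Rep.{u} k G) : IsIso (map f ((permTensorSingle f w k hw).app A) 0) := by
  choose t ht using htrans
  have ht' (x : X) : (t x)⁻¹ • x = w := by rw [inv_smul_eq_iff, ht]
  have hstab (g : G) (hg : g • w = w) (a : A) :
      H0π (Rep.res f A) (A.ρ g a) = H0π (Rep.res f A) a := by
    obtain ⟨s, rfl⟩ := hrange g hg
    exact H0π_ρ_apply (Rep.res f A) s a
  let l : (permTensor X A).V →ₗ[k] groupHomology (Rep.res f A) 0 :=
    lsum (R := k) k fun x => (H0π (Rep.res f A)).hom ∘ₗ A.ρ (t x)⁻¹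
  have hl_single (x : X) (a : A) : l (single x a) = H0π (Rep.res f A) (A.ρ (t x)⁻¹ a) := by
    simp [l]
  have hl : ∀ g, l ∘ₗ (permTensor X A).ρ g = l := fun g => lhom_ext fun x a => by
    rw [LinearMap.comp_apply, permTensor_ρ_single, hl_single, hl_single,
      ← hstab ((t (g • x))⁻¹ * g * t x) (by rw [mul_smul, mul_smul, ht, ht']) (A.ρ (t x)⁻¹ a)]
    simp
  refine ⟨H0Desc _ l hl, ?_, ?_⟩
  · rw [← cancel_epi (H0π (Rep.res f A)), H0π_comp_map_assoc, H0π_comp_H0Desc]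
    ext a
    change l (single w a) = H0π (Rep.res f A) a
    rw [hl_single, hstab _ (ht' w)]
  · rw [← cancel_epi (H0π (permTensor X A)), ← Category.assoc, H0π_comp_H0Desc]
    refine ModuleCat.hom_ext (lhom_ext fun x a => ?_)
    change map f ((permTensorSingle f w k hw).app A) 0 (l (single x a)) =
      H0π (permTensor X A) (single x a)
    rw [hl_single]
    refine (ConcreteCategory.congr_hom (H0π_comp_map f ((permTensorSingle f w k hw).app A))
      (A.ρ (t x)⁻¹ a)).trans ?_
    change H0π (permTensor X A) (single w (A.ρ (t x)⁻¹ a)) = _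
    rw [← H0π_ρ_apply _ (t x), permTensor_ρ_single, ht]
    simp

/-- Shapiro's lemma, by dimension shifting along `ker ⟶ (G →₀ A) ⟶ A`. -/
theorem isIso_map_permTensorSingle (hf : Function.Injective f)
    (hw : ∀ s, f s • w = w) (hrange : ∀ g : G, g • w = w → g ∈ f.range)
    (htrans : ∀ x : X, ∃ g : G, g • w = x) (n : ℕ) (A : Rep.{u} k G) :
    IsIso (map f ((permTensorSingle f w k hw).app A) n) := by
  induction n generalizing A with
  | zero => exact isIso_map_permTensorSingle_zero f w hw hrange htrans A
  | succ n ih =>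
    have hA := shortExact_freeCoverShortComplex A
    have hP := isRelativelyProjective_freeCover A
    exact isIso_map_succ_of_isZero
      (X := (freeCoverShortComplex A).map (Rep.resFunctor f))
      (Y := (freeCoverShortComplex A).map (permTensorFunctor k X))
      ((Rep.shortExact_res f).2 hA) (shortExact_map_permTensorFunctor X hA)
      ((freeCoverShortComplex A).mapNatTrans (permTensorSingle f w k hw)) n
      (isZero_groupHomology_of_isRelativelyProjective (isRelativelyProjective_res hP hf) n)
      (isZero_groupHomology_of_isRelativelyProjective (isRelativelyProjective_permTensor hP X) n)
      (ih _) (ih _)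

end Shapiro

section CycleInduction

open CategoryTheory Limits groupHomology

universe u

section Abelian

variable {A : Type*} [Category* A] [Abelian A] (C : ChainComplex A ℕ)

theorem epi_toCycles_of_exactAt {i : ℕ} (h : C.ExactAt i) : Epi (C.toCycles (i + 1) i) :=
  Preadditive.epi_of_isZero_cokernel' _ (C.homologyIsCokernel (i + 1) i (by simp))
    ((C.exactAt_iff_isZero_homology i).1 h)

/-- The short complex `Z (i + 1) ⟶ C (i + 1) ⟶ Z i`, where `Z` denotes the cycles of `C`. -/
noncomputable abbrev cyclesShortComplex (i : ℕ) : ShortComplex A :=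
  ShortComplex.mk (C.iCycles (i + 1)) (C.toCycles (i + 1) i) (by
    rw [← cancel_mono (C.iCycles i), Category.assoc, C.toCycles_i, C.iCycles_d, zero_comp])

theorem shortExact_cyclesShortComplex {i : ℕ} (h : C.ExactAt i) :
    (cyclesShortComplex C i).ShortExact where
  exact := ShortComplex.exact_of_f_is_kernel _ <|
    KernelFork.IsLimit.ofι' _ _ fun x hx =>
      KernelFork.IsLimit.lift' (C.cyclesIsKernel (i + 1) i (by simp)) x (by
        rw [← C.toCycles_i, reassoc_of% hx, zero_comp])
  mono_f := inferInstance
  epi_g := epi_toCycles_of_exactAt C h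

end Abelian

variable {k G : Type u} [CommRing k] [Group G]

variable {C : ChainComplex (Rep.{u} k G) ℕ} {i q : ℕ}

theorem functor_map_toCycles_comp_map_iCycles :
    (functor k G q).map (C.toCycles (i + 1) i) ≫ (functor k G q).map (C.iCycles i) =
      (functor k G q).map (C.d (i + 1) i) := by
  rw [← Functor.map_comp, C.toCycles_i]

theorem epi_functor_map_toCycles_succ (h : C.ExactAt i)
    (hm : Mono ((functor k G q).map (C.iCycles (i + 1)))) :
    Epi ((functor k G (q + 1)).map (C.toCycles (i + 1) i)) := by
  have hS := shortExact_cyclesShortComplex C h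
  have hδ : δ hS (q + 1) q rfl = 0 :=
    hm.right_cancellation _ _ ((mapShortComplex₁ hS (i := q + 1) rfl).zero.trans zero_comp.symm)
  exact (mapShortComplex₃_exact hS (i := q + 1) rfl).epi_f hδ

theorem mono_functor_map_iCycles_of_mono
    (he : Epi ((functor k G q).map (C.toCycles (i + 1) i)))
    (hm : Mono ((functor k G q).map (C.d (i + 1) i))) :
    Mono ((functor k G q).map (C.iCycles i)) := by
  rw [← functor_map_toCycles_comp_map_iCycles] at hm
  have := mono_of_mono ((functor k G q).map (C.toCycles (i + 1) i))
    ((functor k G q).map (C.iCycles i))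
  have := isIso_of_mono_of_epi ((functor k G q).map (C.toCycles (i + 1) i))
  rw [← IsIso.inv_hom_id_assoc ((functor k G q).map (C.toCycles (i + 1) i))
    ((functor k G q).map (C.iCycles i))]
  infer_instance

theorem mono_functor_map_iCycles_of_epi
    (he : Epi ((functor k G q).map (C.toCycles (i + 1) i)))
    (he' : Epi ((functor k G q).map (C.d (i + 2) (i + 1)))) :
    Mono ((functor k G q).map (C.iCycles i)) := by
  have hzero : (functor k G q).map (C.toCycles (i + 1) i) = 0 := by
    rw [← cancel_epi ((functor k G q).map (C.d (i + 2) (i + 1))), ← Functor.map_comp,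
      C.d_toCycles, Functor.map_zero, comp_zero]
  have hz : IsZero ((functor k G q).obj (C.cycles i)) := by
    rw [IsZero.iff_id_eq_zero, ← cancel_epi ((functor k G q).map (C.toCycles (i + 1) i)), hzero,
      zero_comp, zero_comp]
  exact ⟨fun _ _ _ => hz.eq_of_tgt _ _⟩

theorem epi_functor_map_toCycles {n Q : ℕ} (hC : ∀ i < n, C.ExactAt i)
    (hiso : ∀ i q, q < Q → Even i → i + 2 * q < n → IsIso ((functor k G q).map (C.d (i + 1) i)))
    (hqQ : q ≤ Q) (hi : i < n) (hiq : i + 2 * q ≤ n) (hiq' : Even i → i + 2 * q < n) :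
    Epi ((functor k G q).map (C.toCycles (i + 1) i)) := by
  induction q generalizing i with
  | zero =>
    have := epi_toCycles_of_exactAt C (hC i hi)
    exact epi_map_0_of_epi (C.toCycles (i + 1) i)
  | succ q ih =>
    refine epi_functor_map_toCycles_succ (hC i hi) ?_
    have hepi := ih (i := i + 1) (by omega) (by grind) (by omega) (by grind)
    rcases Nat.even_or_odd i with h | h
    · have := hiso (i + 2) q (by omega) (by grind) (by grind)
      exact mono_functor_map_iCycles_of_epi hepi inferInstance
    · have := hiso (i + 1) q (by omega) (by grind) (by omega)
      exact mono_functor_map_iCycles_of_mono hepi inferInstance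

theorem isIso_functor_map_d_one_zero {n r : ℕ} (hC : ∀ i < n, C.ExactAt i)
    (hiso : ∀ i q, q < r → Even i → i + 2 * q < n → IsIso ((functor k G q).map (C.d (i + 1) i)))
    (hn : 2 ≤ n) (hr : 2 * r < n) (hzero : (functor k G r).map (C.d 2 1) = 0) :
    IsIso ((functor k G r).map (C.d 1 0)) := by
  have hepi : Epi ((functor k G r).map (C.toCycles 1 0)) :=
    epi_functor_map_toCycles hC hiso le_rfl (by omega) (by omega) (by omega)
  have hepi₁ : Epi ((functor k G r).map (C.toCycles 2 1)) :=
    epi_functor_map_toCycles hC hiso le_rfl (by omega) (by omega) (by simp)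
  have hι : (functor k G r).map (C.iCycles 1) = 0 := by
    rw [← cancel_epi ((functor k G r).map (C.toCycles 2 1)),
      functor_map_toCycles_comp_map_iCycles, hzero, comp_zero]
  have hmono : Mono ((functor k G r).map (C.toCycles 1 0)) :=
    (mapShortComplex₂_exact (shortExact_cyclesShortComplex C (hC 0 (by omega))) r).mono_g hι
  have := isIso_of_mono_of_epi ((functor k G r).map (C.toCycles 1 0))
  rw [← functor_map_toCycles_comp_map_iCycles]
  infer_instance

end CycleInduction

section WordComplex

open Finsupp

namespace WordComplex

section Boundary

variable {E M : Type*} [AddCommGroup M]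

/-- Prefixing words by a fixed word, extended linearly. -/
noncomputable def pre (u : List E) : (List E →₀ M) →ₗ[ℤ] (List E →₀ M) :=
  lmapDomain M ℤ (u ++ ·)

@[simp]
theorem pre_single (u v : List E) (c : M) : pre u (single v c) = single (u ++ v) c := by
  simp [pre]

theorem pre_append_apply (u v : List E) (m : List E →₀ M) : pre u m (u ++ v) = m v :=
  mapDomain_apply (List.append_right_injective u) m v

theorem pre_apply_eq_zero {u l : List E} (h : ¬ u <+: l) (m : List E →₀ M) : pre u m l = 0 :=
  mapDomain_of_notMem_range _ _ (by rintro ⟨v, rfl⟩; exact h (List.prefix_append u v))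

theorem pre_append (u v : List E) (m : List E →₀ M) : pre (u ++ v) m = pre u (pre v m) := by
  induction m using Finsupp.induction_linear with
  | zero => simp
  | add _ _ h₁ h₂ => simp only [map_add, h₁, h₂]
  | single => simp

theorem pre_mem_supported {u : List E} {m : List E →₀ M} {V V' : Set (List E)}
    (hm : m ∈ supported M ℤ V) (h : ∀ v ∈ V, u ++ v ∈ V') : pre u m ∈ supported M ℤ V' := by
  classical
  rw [mem_supported] at hm ⊢
  intro l hl
  obtain ⟨v, hv, rfl⟩ := Finset.mem_image.1 (mapDomain_support hl)
  exact h v (hm hv)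

/-- The left inverse of `pre u` that deletes the words not starting with `u`. -/
noncomputable def strip (u : List E) : (List E →₀ M) →ₗ[ℤ] (List E →₀ M) :=
  lcomapDomain (u ++ ·) (List.append_right_injective u)

theorem strip_apply (u v : List E) (m : List E →₀ M) : strip u m v = m (u ++ v) := rfl

theorem strip_pre (u : List E) (m : List E →₀ M) : strip u (pre u m) = m := by
  ext v
  exact pre_append_apply u v m

theorem strip_single_eq_zero {u l : List E} (h : ¬ u <+: l) (c : M) :
    strip u (single l c) = 0 := by
  ext v
  rw [strip_apply, single_eq_of_ne (by rintro rfl; exact h (List.prefix_append u v)),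
    Finsupp.zero_apply]

theorem sum_pre_strip [DecidableEq E] {T : Finset (List E)} {j : ℕ} (hT : ∀ P ∈ T, P.length = j)
    (z : List E →₀ M) : ∑ P ∈ T, pre P (strip P z) = z.filter fun l => l.take j ∈ T := by
  ext l
  have eq_take {P : List E} (hP : P ∈ T) (h : P <+: l) : P = l.take j := by
    rw [List.prefix_iff_eq_take.1 h, hT P hP]
  rw [Finsupp.finsetSum_apply]
  by_cases hl : l.take j ∈ T
  · rw [filter_apply_pos (fun l : List E => l.take j ∈ T) _ hl,
      Finset.sum_eq_single_of_mem _ hl fun P hP hne =>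
        pre_apply_eq_zero (fun h => hne (eq_take hP h)) _]
    conv_lhs => rw [← List.take_append_drop j l, List.take_append_drop j l]
    have := pre_append_apply (l.take j) (l.drop j) (strip (l.take j) z)
    rwa [strip_apply, List.take_append_drop] at this
  · rw [filter_apply_neg (fun l : List E => l.take j ∈ T) _ hl]
    exact Finset.sum_eq_zero fun P hP =>
      pre_apply_eq_zero (fun h => hl (eq_take hP h ▸ hP)) _

/-- The boundary of a word with coefficient: the alternating sum over the deletions of a letter. -/
noncomputable def wordBoundary : List E → M →ₗ[ℤ] (List E →₀ M)
  | [] => 0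
  | x :: l => lsingle l - pre [x] ∘ₗ wordBoundary l

/-- The boundary operator on linear combinations of words. -/
noncomputable def boundary : (List E →₀ M) →ₗ[ℤ] (List E →₀ M) :=
  lsum ℤ wordBoundary

theorem boundary_single_nil (c : M) : boundary (single ([] : List E) c) = 0 := by
  simp only [boundary, lsum_single, wordBoundary, LinearMap.zero_apply]

theorem boundary_pre_singleton (x : E) (m : List E →₀ M) :
    boundary (pre [x] m) = m - pre [x] (boundary m) := by
  induction m using Finsupp.induction_linear with
  | zero => simp
  | add _ _ h₁ h₂ => simp only [map_add, h₁, h₂]; abel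
  | single => simp [boundary, wordBoundary]

theorem boundary_pre (u : List E) (m : List E →₀ M) :
    boundary (pre u m) = (-1 : ℤ) ^ u.length • pre u (boundary m) +
      ∑ i ∈ Finset.range u.length, (-1 : ℤ) ^ i • pre (u.eraseIdx i) m := by
  induction u with
  | nil =>
    have pre_nil (m : List E →₀ M) : pre [] m = m := mapDomain_id
    simp [pre_nil]
  | cons x u ih =>
    rw [← List.singleton_append, pre_append, boundary_pre_singleton, ih]
    simp only [List.singleton_append, List.length_cons, Finset.sum_range_succ', List.eraseIdx_zero,
      List.tail_cons, List.eraseIdx_cons_succ, pow_zero, one_smul, map_add, map_sum, map_smul,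
      ← pre_append, pow_succ, mul_neg, mul_one, neg_smul, Finset.sum_neg_distrib]
    abel

theorem boundary_single (l : List E) (c : M) :
    boundary (single l c) =
      ∑ i ∈ Finset.range l.length, (-1 : ℤ) ^ i • single (l.eraseIdx i) c := by
  simpa [boundary_single_nil] using boundary_pre l (single [] c)

theorem boundary_boundary (m : List E →₀ M) : boundary (boundary m) = 0 := by
  induction m using Finsupp.induction_linear with
  | zero => simp
  | add _ _ h₁ h₂ => simp only [map_add, h₁, h₂, add_zero]
  | single l c =>
    induction l with
    | nil => simp [boundary_single_nil]
    | cons x l ih =>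
      have hx : single (x :: l) c = pre [x] (single l c) := by simp
      rw [hx, boundary_pre_singleton, map_sub, boundary_pre_singleton, ih, map_zero, sub_zero,
        sub_self]

theorem boundary_mem_supported {V V' : Set (List E)} {m : List E →₀ M}
    (hm : m ∈ supported M ℤ V) (h : ∀ l ∈ V, ∀ i < l.length, l.eraseIdx i ∈ V') :
    boundary m ∈ supported M ℤ V' := by
  rw [← m.sum_single, Finsupp.sum, map_sum]
  refine sum_mem fun l hl => ?_
  rw [boundary_single]
  exact sum_mem fun i hi => Submodule.smul_mem _ _ <|
    single_mem_supported _ _ (h l (hm hl) i (Finset.mem_range.1 hi))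

end Boundary

section Acyclicity

variable {E ι M : Type*} [AddCommGroup M] (p : E → ι)

/-- Words whose letters of index `a` all occur among the first `j` positions. -/
def avoidsFrom (a : ι) (j : ℕ) : Set (List E) :=
  {l | ∀ x ∈ l.drop j, p x ≠ a}

variable {p}

theorem not_prefix_eraseIdx {u l : List E} {e : E} {i : ℕ} (hi : i ≤ u.length)
    (hl : l ∈ avoidsFrom p (p e) (u.length + 1)) : ¬ u ++ [e] <+: l.eraseIdx i := by
  rintro ⟨v, hv⟩
  refine hl e ?_ rfl
  have hdrop : (l.eraseIdx i).drop u.length = l.drop (u.length + 1) := by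
    rcases le_total i l.length with h | h
    · rw [List.eraseIdx_eq_take_drop_succ, List.drop_append,
        List.drop_eq_nil_of_le (by simp; omega), List.nil_append, List.drop_drop,
        List.length_take, min_eq_left h]
      congr 1
      omega
    · rw [List.eraseIdx_of_length_le h, List.drop_eq_nil_of_le (h.trans hi),
        List.drop_eq_nil_of_le (by omega)]
  rw [← hdrop, ← hv]
  simp

theorem strip_boundary_single {u l : List E} {e : E}
    (hl : l ∈ avoidsFrom p (p e) (u.length + 1)) (c : M) :
    strip (u ++ [e]) (boundary (single l c)) =
      (-1 : ℤ) ^ (u.length + 1) • boundary (strip (u ++ [e]) (single l c)) := by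
  by_cases hstart : u ++ [e] <+: l
  · obtain ⟨v, rfl⟩ := hstart
    rw [← pre_single, boundary_pre, map_add, map_smul, strip_pre, strip_pre, map_sum,
      Finset.sum_eq_zero, add_zero, List.length_append, List.length_singleton]
    intro i hi
    have hi : i < (u ++ [e]).length := Finset.mem_range.1 hi
    rw [map_smul, pre_single, ← List.eraseIdx_append_of_lt_length hi,
      strip_single_eq_zero (not_prefix_eraseIdx (by simpa [Nat.lt_succ_iff] using hi) hl),
      smul_zero]
  · rw [strip_single_eq_zero hstart, map_zero, smul_zero, boundary_single, map_sum]
    refine Finset.sum_eq_zero fun i _ => ?_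
    rw [map_smul, strip_single_eq_zero, smul_zero]
    rcases le_or_gt i u.length with hi | hi
    · exact not_prefix_eraseIdx hi hl
    · intro h
      have htake : u ++ [e] <+: (l.eraseIdx i).take i :=
        List.prefix_take_iff.2 ⟨h, by simpa using hi⟩
      rw [List.take_eraseIdx_eq_take_of_le _ _ _ le_rfl] at htake
      exact hstart (List.prefix_take_iff.1 htake).1

theorem boundary_strip_eq_zero {u : List E} {e : E} {z : List E →₀ M}
    (hz : z ∈ supported M ℤ (avoidsFrom p (p e) (u.length + 1))) (hbz : boundary z = 0) :
    boundary (strip (u ++ [e]) z) = 0 := by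
  have hcomm : strip (u ++ [e]) (boundary z) =
      (-1 : ℤ) ^ (u.length + 1) • boundary (strip (u ++ [e]) z) := by
    rw [← z.sum_single, Finsupp.sum]
    simp only [map_sum, Finset.smul_sum]
    exact Finset.sum_congr rfl fun l hl => strip_boundary_single (hz hl) _
  rw [hbz, map_zero] at hcomm
  rcases neg_one_pow_eq_or ℤ (u.length + 1) with h | h <;> rw [h] at hcomm <;>
    simpa using hcomm.symm

variable (p) in
/-- Words of length `k` whose letters have distinct indices in `s`. -/
def words (s : Finset ι) (k : ℕ) : Set (List E) :=
  {l | l.length = k ∧ (l.map p).Nodup ∧ ∀ x ∈ l, p x ∈ s}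

theorem boundary_mem_supported_words {s : Finset ι} {k : ℕ} {m : List E →₀ M}
    (hm : m ∈ supported M ℤ (words p s (k + 1))) : boundary m ∈ supported M ℤ (words p s k) :=
  boundary_mem_supported hm fun l ⟨hlen, hnodup, hs⟩ i hi =>
    have hsub := l.eraseIdx_sublist i
    ⟨by rw [List.length_eraseIdx_of_lt hi, hlen, Nat.add_sub_cancel],
      hnodup.sublist (hsub.map p), fun x hx => hs x (hsub.subset hx)⟩

theorem append_mem_words_iff [DecidableEq ι] {s : Finset ι} {u v : List E} {k : ℕ} :
    u ++ v ∈ words p s (u.length + k) ↔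
      u ∈ words p s u.length ∧ v ∈ words p (s \ (u.map p).toFinset) k := by
  simp only [words, Set.mem_ofPred_eq, List.length_append, List.map_append, List.nodup_append,
    List.mem_append, Finset.mem_sdiff, List.mem_toFinset]
  grind

theorem append_singleton_mem_of_take {a : ι} {j : ℕ} {l : List E}
    (h : l ∈ avoidsFrom p a (j + 1)) (h' : l ∉ avoidsFrom p a j) :
    ∃ u e, l.take (j + 1) = u ++ [e] ∧ u.length = j ∧ p e = a := by
  have hj : j < l.length := by
    by_contra! hlen
    exact h' (by simp [avoidsFrom, List.drop_eq_nil_of_le hlen])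
  refine ⟨l.take j, l[j], (List.take_append_getElem hj).symm, by simp; omega, ?_⟩
  by_contra hne
  refine h' fun x hx => ?_
  rw [List.drop_eq_getElem_cons hj, List.mem_cons] at hx
  rcases hx with rfl | hx
  · exact hne
  · exact h x hx

theorem cons_mem_words {s : Finset ι} {k : ℕ} {e : E} {l : List E} (he : p e ∈ s)
    (hl : l ∈ words p s k) (hl' : l ∈ avoidsFrom p (p e) 0) : e :: l ∈ words p s (k + 1) := by
  obtain ⟨hlen, hnodup, hs⟩ := hl
  refine ⟨by simp [hlen], ?_, by simpa using ⟨he, hs⟩⟩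
  simpa [List.nodup_cons, hnodup, avoidsFrom] using hl'

variable (M p) in
/-- Exactness, below the top length, of the complex of words with distinct indices in `s`. -/
def Acyclic (s : Finset ι) : Prop :=
  ∀ k < s.card, ∀ z ∈ supported M ℤ (words p s k), boundary z = 0 →
    ∃ y ∈ supported M ℤ (words p s (k + 1)), boundary y = z

-- Bounding `strip P z` over the indices not used by `P` and prefixing `P` again leaves an error
-- consisting of words that miss a letter of `P`.
theorem exists_boundary_sub_pre_strip_mem {s : Finset ι} (ih : ∀ t ⊂ s, Acyclic M p t)
    {u : List E} {e : E} {i : ℕ} (hP : u ++ [e] ∈ words p s (u ++ [e]).length)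
    (hi : (u ++ [e]).length + i < s.card) {z : List E →₀ M}
    (hz : z ∈ supported M ℤ (words p s ((u ++ [e]).length + i)))
    (hz' : z ∈ supported M ℤ (avoidsFrom p (p e) (u.length + 1))) (hbz : boundary z = 0) :
    ∃ y ∈ supported M ℤ (words p s ((u ++ [e]).length + i + 1)),
      boundary y - pre (u ++ [e]) (strip (u ++ [e]) z) ∈
        supported M ℤ (avoidsFrom p (p e) u.length) := by
  classical
  set t := s \ ((u ++ [e]).map p).toFinset with ht
  have hsub : ((u ++ [e]).map p).toFinset ⊆ s := fun a ha => by
    obtain ⟨x, hx, rfl⟩ := List.mem_map.1 (List.mem_toFinset.1 ha)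
    exact hP.2.2 x hx
  have hcard : t.card = s.card - (u ++ [e]).length := by
    rw [ht, Finset.card_sdiff_of_subset hsub, List.toFinset_card_of_nodup hP.2.1, List.length_map]
  have hts : t ⊂ s := Finset.ssubset_iff_subset_ne.2
    ⟨Finset.sdiff_subset, fun h => by rw [h, List.length_append] at hcard; simp at hcard; omega⟩
  have hstrip : strip (u ++ [e]) z ∈ supported M ℤ (words p t i) := fun v hv => by
    have hv : (u ++ [e]) ++ v ∈ z.support := by
      rwa [SetLike.mem_coe, mem_support_iff, strip_apply, ← mem_support_iff] at hv
    exact (append_mem_words_iff.1 (hz hv)).2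
  obtain ⟨y, hy, hby⟩ := ih t hts i (by omega) _ hstrip (boundary_strip_eq_zero hz' hbz)
  refine ⟨(-1 : ℤ) ^ (u ++ [e]).length • pre (u ++ [e]) y, Submodule.smul_mem _ _
    (pre_mem_supported hy fun v hv => append_mem_words_iff.2 ⟨hP, hv⟩), ?_⟩
  rw [map_smul, boundary_pre, hby, smul_add, smul_smul, ← mul_pow, neg_one_mul, neg_neg, one_pow,
    one_smul, add_sub_cancel_left]
  refine Submodule.smul_mem _ _ (sum_mem fun m hm => Submodule.smul_mem _ _
    (pre_mem_supported hy fun v hv x hx hxe => ?_))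
  have hlen : ((u ++ [e]).eraseIdx m).length = u.length := by
    rw [List.length_eraseIdx_of_lt (Finset.mem_range.1 hm)]
    simp
  rw [← hlen, List.drop_left] at hx
  exact (Finset.mem_sdiff.1 (hv.2.2 x hx)).2 (by simp [hxe])

theorem exists_sub_boundary_mem_avoidsFrom {s : Finset ι} (ih : ∀ t ⊂ s, Acyclic M p t) (a : ι)
    {j i : ℕ} (hi : j + 1 + i < s.card) {z : List E →₀ M}
    (hz : z ∈ supported M ℤ (words p s (j + 1 + i)))
    (hz' : z ∈ supported M ℤ (avoidsFrom p a (j + 1))) (hbz : boundary z = 0) :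
    ∃ y ∈ supported M ℤ (words p s (j + 1 + i + 1)),
      z - boundary y ∈ supported M ℤ (avoidsFrom p a j) := by
  classical
  let T := (z.support.filter (· ∉ avoidsFrom p a j)).image (List.take (j + 1))
  have hT : ∀ P ∈ T, ∃ u e, P = u ++ [e] ∧ u.length = j ∧ p e = a ∧
      u ++ [e] ∈ words p s (u ++ [e]).length := by
    intro P hP
    obtain ⟨l, hl, rfl⟩ := Finset.mem_image.1 hP
    obtain ⟨hl, hlj⟩ := Finset.mem_filter.1 hl
    obtain ⟨-, hnodup, hs⟩ := hz hl
    obtain ⟨u, e, hue, hu, he⟩ := append_singleton_mem_of_take (hz' hl) hlj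
    have hsub := l.take_sublist (j + 1)
    exact ⟨u, e, hue, hu, he, hue ▸ ⟨rfl, hnodup.sublist (hsub.map p),
      fun x hx => hs x (hsub.subset hx)⟩⟩
  have hY : ∀ P ∈ T, ∃ y ∈ supported M ℤ (words p s (j + 1 + i + 1)),
      boundary y - pre P (strip P z) ∈ supported M ℤ (avoidsFrom p a j) := by
    intro P hP
    obtain ⟨u, e, rfl, rfl, rfl, hue⟩ := hT P hP
    have hlen : (u ++ [e]).length = u.length + 1 := by simp
    rw [← hlen] at hi hz
    simpa only [hlen] using exists_boundary_sub_pre_strip_mem ih hue hi hz hz' hbz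
  choose! Y hYmem hY using hY
  refine ⟨∑ P ∈ T, Y P, sum_mem hYmem, ?_⟩
  have hlen : ∀ P ∈ T, P.length = j + 1 := fun P hP => by
    obtain ⟨u, e, rfl, rfl, -⟩ := hT P hP
    simp
  have hrest : z - ∑ P ∈ T, pre P (strip P z) ∈ supported M ℤ (avoidsFrom p a j) := by
    rw [sum_pre_strip hlen, mem_supported']
    intro l hl
    rw [Finsupp.sub_apply, filter_apply]
    split_ifs with hlT
    · exact sub_self _
    · rw [sub_zero]
      by_contra hzl
      exact hlT (Finset.mem_image_of_mem _ (Finset.mem_filter.2 ⟨mem_support_iff.2 hzl, hl⟩))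
  have := sub_mem hrest (sum_mem hY)
  rwa [Finset.sum_sub_distrib, sub_sub_sub_cancel_right, ← map_sum] at this

theorem exists_sub_boundary_mem_avoidsFrom_zero {s : Finset ι} (ih : ∀ t ⊂ s, Acyclic M p t)
    (a : ι) {k : ℕ} (hk : k < s.card) {z : List E →₀ M}
    (hz : z ∈ supported M ℤ (words p s k)) (hbz : boundary z = 0) :
    ∃ y ∈ supported M ℤ (words p s (k + 1)),
      z - boundary y ∈ supported M ℤ (avoidsFrom p a 0) := by
  refine Nat.decreasingInduction (motive := fun j _ => ∃ y ∈ supported M ℤ (words p s (k + 1)),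
    z - boundary y ∈ supported M ℤ (avoidsFrom p a j)) ?_ ?_ (Nat.zero_le k)
  · rintro j hj ⟨y, hy, hyj⟩
    obtain ⟨i, rfl⟩ := Nat.exists_eq_add_of_le hj
    obtain ⟨y', hy', hyj'⟩ := exists_sub_boundary_mem_avoidsFrom ih a hk
      (sub_mem hz (boundary_mem_supported_words hy)) hyj
      (by rw [map_sub, hbz, boundary_boundary, sub_zero])
    exact ⟨y + y', add_mem hy hy', by rwa [map_add, ← sub_sub]⟩
  · refine ⟨0, zero_mem _, ?_⟩
    rw [map_zero, sub_zero]
    refine supported_mono (fun l hl => ?_) hz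
    simp [avoidsFrom, List.drop_eq_nil_of_le hl.1.le]

theorem acyclic {s : Finset ι} (hs : ↑s ⊆ Set.range p) : Acyclic M p s := by
  induction s using Finset.strongInduction with
  | H s ih =>
    intro k hk z hz hbz
    obtain ⟨a, ha⟩ := Finset.card_pos.1 (by omega : 0 < s.card)
    obtain ⟨e, rfl⟩ := hs ha
    obtain ⟨y, hy, hyj⟩ := exists_sub_boundary_mem_avoidsFrom_zero
      (fun t ht => ih t ht fun _ h => hs (ht.subset h)) (p e) hk hz hbz
    have hz' : z - boundary y ∈ supported M ℤ (words p s k ∩ avoidsFrom p (p e) 0) := by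
      rw [supported_inter]
      exact ⟨sub_mem hz (boundary_mem_supported_words hy), hyj⟩
    refine ⟨y + pre [e] (z - boundary y),
      add_mem hy (pre_mem_supported hz' fun l hl => cons_mem_words ha hl.1 hl.2), ?_⟩
    rw [map_add, boundary_pre_singleton, map_sub boundary, hbz, boundary_boundary]
    simp

end Acyclicity

end WordComplex

end WordComplex

section SignedWords

namespace SignedSet

variable {n : ℕ}

/-- The absolute value of a signed letter. Words are required to have distinct absolute values. -/
def natAbs (x : SignedSet n) : ℕ := x.1.natAbs

theorem abs_le_natCast_iff {z : ℤ} {m : ℕ} : |z| ≤ (m : ℤ) ↔ z.natAbs ≤ m := by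
  rw [Int.abs_eq_natAbs, Nat.cast_le]

theorem natAbs_pos (x : SignedSet n) : 0 < natAbs x := Int.natAbs_pos.2 x.2.1

theorem natAbs_le (x : SignedSet n) : natAbs x ≤ n := abs_le_natCast_iff.1 x.2.2

theorem natAbs_eq_natAbs_iff {x y : SignedSet n} : natAbs x = natAbs y ↔ x = y ∨ x = -y :=
  Int.natAbs_eq_natAbs_iff.trans (or_congr Subtype.ext_iff.symm (Subtype.ext_iff (a2 := -y)).symm)

theorem neg_ne_self (x : SignedSet n) : -x ≠ x := fun h =>
  x.2.1 (self_eq_neg.1 (congrArg Subtype.val h).symm)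

/-- The letter `n - i`. -/
def letter {i : ℕ} (h : i < n) : SignedSet n :=
  ⟨n - i, by omega, abs_le_natCast_iff.2 (by omega)⟩

theorem natAbs_letter {i : ℕ} (h : i < n) : natAbs (letter h) = n - i := by
  simp only [natAbs, letter]
  omega

theorem coe_Icc_subset_range_natAbs :
    ↑(Finset.Icc 1 n) ⊆ Set.range (natAbs : SignedSet n → ℕ) := fun i hi => by
  obtain ⟨h₁, h₂⟩ := Finset.mem_Icc.1 hi
  exact ⟨letter (i := n - i) (by omega), by rw [natAbs_letter]; omega⟩

theorem mem_range_incl {m : ℕ} (h : m ≤ n) {x : SignedSet n} :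
    x ∈ Set.range (incl h) ↔ natAbs x ≤ m :=
  ⟨fun ⟨y, hy⟩ => hy ▸ y.natAbs_le, fun hx => ⟨⟨x.1, x.2.1, abs_le_natCast_iff.2 hx⟩, rfl⟩⟩

end SignedSet

namespace SignedPerm

open SignedSet

variable {n : ℕ}

theorem natAbs_apply_eq_iff (g : SignedPerm n) {x y : SignedSet n} :
    natAbs (g.1 x) = natAbs (g.1 y) ↔ natAbs x = natAbs y := by
  rw [natAbs_eq_natAbs_iff, natAbs_eq_natAbs_iff, ← g.2 y, g.1.injective.eq_iff,
    g.1.injective.eq_iff]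

section Swap

open Classical in
/-- The signed transposition exchanging `a` with `b` and `-a` with `-b`, as a function. -/
noncomputable def swapFun (a b x : SignedSet n) : SignedSet n :=
  if x = a then b else if x = b then a else if x = -a then -b else if x = -b then -a else x

theorem swapFun_swapFun (a b x : SignedSet n) : swapFun a b (swapFun a b x) = x := by
  grind [swapFun, SignedSet.neg_ne_self, neg_neg']

theorem swapFun_neg (a b x : SignedSet n) : swapFun a b (-x) = -swapFun a b x := by
  grind [swapFun, SignedSet.neg_ne_self, neg_neg']

/-- The signed transposition exchanging `a` with `b` and `-a` with `-b`. -/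
noncomputable def swap (a b : SignedSet n) : SignedPerm n :=
  ⟨⟨swapFun a b, swapFun a b, swapFun_swapFun a b, swapFun_swapFun a b⟩, swapFun_neg a b⟩

theorem swap_apply_left (a b : SignedSet n) : (swap a b).1 a = b := if_pos rfl

theorem swap_apply_of_natAbs_ne {a b x : SignedSet n} (ha : natAbs x ≠ natAbs a)
    (hb : natAbs x ≠ natAbs b) : (swap a b).1 x = x := by
  rw [Ne, natAbs_eq_natAbs_iff, not_or] at ha hb
  change swapFun a b x = x
  simp [swapFun, ha, hb]

end Swap

theorem exists_map_eq {l l' : List (SignedSet n)} (hlen : l.length = l'.length)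
    (hl : (l.map natAbs).Nodup) (hl' : (l'.map natAbs).Nodup) :
    ∃ g : SignedPerm n, l.map g.1 = l' ∧
      ∀ x, natAbs x ∉ l.map natAbs → natAbs x ∉ l'.map natAbs → g.1 x = x := by
  induction l generalizing l' with
  | nil => exact ⟨1, (List.length_eq_zero_iff.1 hlen.symm).symm, fun _ _ _ => rfl⟩
  | cons a l ih =>
    obtain ⟨b, l', rfl⟩ := List.exists_cons_of_length_eq_add_one hlen.symm
    rw [List.map_cons, List.nodup_cons] at hl hl'
    obtain ⟨g, rfl, hg⟩ := ih (Nat.succ.inj hlen) hl.2 hl'.2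
    refine ⟨swap (g.1 a) b * g, ?_, fun x hx hx' => ?_⟩
    · refine congrArg₂ List.cons (swap_apply_left _ _) (List.map_congr_left fun x hx => ?_)
      refine swap_apply_of_natAbs_ne (fun h => hl.1 ?_) fun h => hl'.1 ?_
      · exact (natAbs_apply_eq_iff g).1 h ▸ List.mem_map_of_mem hx
      · exact h ▸ List.mem_map_of_mem (List.mem_map_of_mem hx)
    · rw [List.map_cons, List.mem_cons, not_or] at hx hx'
      change (swap (g.1 a) b).1 (g.1 x) = x
      rw [swap_apply_of_natAbs_ne (mt (natAbs_apply_eq_iff g).1 hx.1)] <;>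
        rw [hg x hx.2 hx'.2]
      exact hx'.1

section Incl

variable {m : ℕ} (h : m ≤ n)

theorem incl_apply_incl (s : SignedPerm m) (y : SignedSet m) :
    (incl h s).1 (SignedSet.incl h y) = SignedSet.incl h (s.1 y) :=
  Equiv.Perm.viaEmbedding_apply _ _ _

theorem incl_apply_of_lt (s : SignedPerm m) {x : SignedSet n} (hx : m < natAbs x) :
    (incl h s).1 x = x :=
  Equiv.Perm.viaEmbedding_apply_of_notMem _ _ _ (by rwa [SignedSet.mem_range_incl, not_le])

variable {h} in
theorem incl_eq_of_apply {s : SignedPerm m} {g : SignedPerm n}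
    (hs : ∀ y, g.1 (SignedSet.incl h y) = SignedSet.incl h (s.1 y))
    (hg : ∀ x, m < natAbs x → g.1 x = x) : incl h s = g := by
  refine Subtype.ext (Equiv.ext fun x => ?_)
  rcases le_or_gt (natAbs x) m with hx | hx
  · obtain ⟨y, rfl⟩ := (SignedSet.mem_range_incl h).2 hx
    rw [incl_apply_incl, hs]
  · rw [incl_apply_of_lt h s hx, hg x hx]

theorem incl_injective : Function.Injective (incl h) := fun _ _ hg =>
  Subtype.ext (Equiv.Perm.viaEmbeddingHom_injective _ (congrArg Subtype.val hg))

theorem incl_comp_incl {l : ℕ} (h' : l ≤ m) : (incl h).comp (incl h') = incl (h'.trans h) := by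
  refine MonoidHom.ext fun s => (incl_eq_of_apply (fun z => ?_) fun x hx => ?_).symm
  · change (incl h (incl h' s)).1 (SignedSet.incl h (SignedSet.incl h' z)) = _
    rw [incl_apply_incl, incl_apply_incl]
    rfl
  · rcases le_or_gt (natAbs x) m with hxm | hxm
    · obtain ⟨y, rfl⟩ := (SignedSet.mem_range_incl h).2 hxm
      refine (incl_apply_incl h _ y).trans (congrArg _ (incl_apply_of_lt h' s hx))
    · exact incl_apply_of_lt h _ hxm

theorem conj_incl {g : SignedPerm n} (hg : ∀ x, natAbs x ≤ m → g.1 x = x) (s : SignedPerm m) :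
    g * incl h s * g⁻¹ = incl h s := by
  rw [mul_inv_eq_iff_eq_mul]
  refine Subtype.ext (Equiv.ext fun x => ?_)
  change g.1 ((incl h s).1 x) = (incl h s).1 (g.1 x)
  rcases le_or_gt (natAbs x) m with hx | hx
  · rw [hg x hx]
    obtain ⟨y, rfl⟩ := (SignedSet.mem_range_incl h).2 hx
    rw [incl_apply_incl]
    exact hg _ (natAbs_le (s.1 y))
  · have hgx : m < natAbs (g.1 x) := by
      by_contra! hgx
      rw [g.1.injective (hg _ hgx)] at hgx
      omega
    rw [incl_apply_of_lt h s hx, incl_apply_of_lt h s hgx]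

theorem mem_range_incl {g : SignedPerm n} (hg : ∀ x, m < natAbs x → g.1 x = x) :
    g ∈ (incl h).range := by
  have hstable (x : SignedSet n) :
      g.1 x ∈ Set.range (SignedSet.incl h) ↔ x ∈ Set.range (SignedSet.incl h) := by
    rw [SignedSet.mem_range_incl, SignedSet.mem_range_incl, ← not_lt, ← not_lt, not_iff_not]
    refine ⟨fun hx => ?_, fun hx => by rwa [hg x hx]⟩
    rwa [g.1.injective (hg _ hx)] at hx
  let e : Equiv.Perm (SignedSet m) :=
    (Equiv.ofInjective _ (SignedSet.incl h).injective).symm.permCongr (g.1.subtypePerm hstable)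
  have he (y : SignedSet m) : SignedSet.incl h (e y) = g.1 (SignedSet.incl h y) :=
    Equiv.apply_ofInjective_symm (SignedSet.incl h).injective _
  have he_neg : e ∈ SignedPerm m := fun y => (SignedSet.incl h).injective <| by
    rw [he, SignedSet.incl_neg, SignedSet.incl_neg, he, g.2]
  exact ⟨⟨e, he_neg⟩, incl_eq_of_apply (fun y => (he y).symm) hg⟩

end Incl

end SignedPerm

open SignedSet

/-- Words of length `k` in the letters `±1, …, ±n` with distinct absolute values. -/
def SignedWord (n k : ℕ) : Type :=
  {l : List (SignedSet n) // l.length = k ∧ (l.map natAbs).Nodup}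

namespace SignedWord

variable {n k : ℕ}

theorem ext {u v : SignedWord n k} (h : u.1 = v.1) : u = v := Subtype.ext h

theorem nodup_map_natAbs_map (g : SignedPerm n) {l : List (SignedSet n)}
    (hl : (l.map natAbs).Nodup) : ((l.map g.1).map natAbs).Nodup := by
  rw [List.Nodup, List.pairwise_map] at hl
  rw [List.Nodup, List.pairwise_map, List.pairwise_map]
  exact hl.imp (mt (SignedPerm.natAbs_apply_eq_iff g).1)

instance : MulAction (SignedPerm n) (SignedWord n k) where
  smul g w := ⟨w.1.map g.1, by rw [List.length_map, w.2.1], nodup_map_natAbs_map g w.2.2⟩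
  one_smul w := ext (List.map_id _)
  mul_smul g h w := ext (List.map_map (f := h.1) (g := g.1) (l := w.1)).symm

theorem exists_smul_eq (u v : SignedWord n k) : ∃ g : SignedPerm n, g • u = v ∧
    ∀ x, natAbs x ∉ u.1.map natAbs → natAbs x ∉ v.1.map natAbs → g.1 x = x := by
  obtain ⟨g, hg, hfix⟩ := SignedPerm.exists_map_eq (u.2.1.trans v.2.1.symm) u.2.2 v.2.2
  exact ⟨g, ext hg, hfix⟩

theorem smul_eq_self_iff (g : SignedPerm n) (w : SignedWord n k) :
    g • w = w ↔ ∀ x, natAbs x ∈ w.1.map natAbs → g.1 x = x := by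
  have hmap : g • w = w ↔ ∀ x ∈ w.1, g.1 x = x := by
    have hval : g • w = w ↔ w.1.map g.1 = w.1.map id := by
      rw [List.map_id]
      exact Subtype.ext_iff
    exact hval.trans List.map_inj_left
  rw [hmap]
  refine ⟨fun hg x hx => ?_, fun hg x hx => hg x (List.mem_map_of_mem hx)⟩
  obtain ⟨y, hy, hyx⟩ := List.mem_map.1 hx
  rcases natAbs_eq_natAbs_iff.1 hyx.symm with rfl | rfl
  · exact hg x hy
  · rw [g.2, hg y hy]

/-- Deleting the `i`-th letter. -/
def face (i : Fin (k + 1)) (w : SignedWord n (k + 1)) : SignedWord n k :=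
  ⟨w.1.eraseIdx i, by
    rw [List.length_eraseIdx_of_lt (by rw [w.2.1]; exact i.2), w.2.1]; rfl,
    w.2.2.sublist ((List.eraseIdx_sublist _ _).map _)⟩

theorem smul_face (g : SignedPerm n) (i : Fin (k + 1)) (w : SignedWord n (k + 1)) :
    g • face i w = face i (g • w) :=
  ext (List.eraseIdx_map ..).symm

/-- The word `n, n - 1, …, n - k + 1`. -/
def std (h : k ≤ n) : SignedWord n k :=
  ⟨List.ofFn fun i : Fin k => letter (i.2.trans_le h), List.length_ofFn, by
    rw [List.map_ofFn, List.nodup_ofFn]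
    intro i j hij
    simp only [Function.comp_apply, natAbs_letter] at hij
    omega⟩

theorem natAbs_mem_map_std_iff (h : k ≤ n) {x : SignedSet n} :
    natAbs x ∈ (std h).1.map natAbs ↔ n - k < natAbs x := by
  have hpos := x.natAbs_pos
  have hle := x.natAbs_le
  rw [std, List.map_ofFn, List.mem_ofFn']
  simp only [Set.mem_range, Function.comp_apply, natAbs_letter]
  exact ⟨fun ⟨i, hi⟩ => by omega, fun hx => ⟨⟨n - natAbs x, by omega⟩, by dsimp only; omega⟩⟩

theorem smul_std_eq_iff (h : k ≤ n) (g : SignedPerm n) :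
    g • std h = std h ↔ ∀ x, n - k < natAbs x → g.1 x = x := by
  simp only [smul_eq_self_iff, natAbs_mem_map_std_iff]

theorem exists_smul_std_eq_face (h : k + 1 ≤ n) (i : Fin (k + 1)) :
    ∃ g : SignedPerm n, (∀ x, natAbs x ≤ n - (k + 1) → g.1 x = x) ∧
      g • std (k.le_succ.trans h) = face i (std h) := by
  obtain ⟨g, hg, hfix⟩ := exists_smul_eq (std (k.le_succ.trans h)) (face i (std h))
  refine ⟨g, fun x hx => hfix x ?_ fun hmem => ?_, hg⟩
  · rw [natAbs_mem_map_std_iff]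
    omega
  · have := (natAbs_mem_map_std_iff h).1 (((List.eraseIdx_sublist _ _).map _).subset hmem)
    omega

end SignedWord

end SignedWords

section Stabilization

open CategoryTheory Finsupp groupHomology

section Functoriality

universe u

variable {k G : Type u} [CommRing k] [Group G]

instance chainsFunctor_additive : (chainsFunctor k G).Additive where
  map_add {A B φ ψ} := by
    refine HomologicalComplex.hom_ext _ _ fun i => ModuleCat.hom_ext (lhom_ext fun g a => ?_)
    change (chainsMap (MonoidHom.id G) (φ + ψ)).f i (single g a) =
      (chainsMap (MonoidHom.id G) φ).f i (single g a) +
        (chainsMap (MonoidHom.id G) ψ).f i (single g a)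
    rw [chainsMap_f_single, chainsMap_f_single, chainsMap_f_single, ← single_add]
    rfl

instance groupHomologyFunctor_additive (n : ℕ) : (functor k G n).Additive :=
  inferInstanceAs (chainsFunctor k G ⋙ HomologicalComplex.homologyFunctor _ _ n).Additive

theorem map_comp_map_of_apply {H K : Type u} [Group H] [Group K] {A : Rep.{u} k G}
    {B : Rep.{u} k H} {C : Rep.{u} k K} {f : G →* H} {g : H →* K} {e : G →* K}
    {φ : A ⟶ Rep.res f B} {ψ : B ⟶ Rep.res g C} {χ : A ⟶ Rep.res e C} (he : g.comp f = e)
    (h : ∀ x, ψ.hom (φ.hom x) = χ.hom x) (n : ℕ) : map f φ n ≫ map g ψ n = map e χ n := by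
  rw [← map_comp]
  exact map_congr he (LinearMap.ext h) n

variable (k) (M : Type u) [AddCommGroup M] [Module k M] {H : Type u} [Group H]

/-- The map `H_r(G; M) ⟶ H_r(H; M)` induced by a group homomorphism `f : G →* H` and the identity
of the trivial module `M`. -/
noncomputable abbrev trivialMap (f : G →* H) (r : ℕ) :
    groupHomology (Rep.trivial k G M) r ⟶ groupHomology (Rep.trivial k H M) r :=
  map (A := Rep.trivial k G M) (B := Rep.trivial k H M) f (𝟙 (Rep.trivial k G M)) r

theorem isIso_trivialMap_zero (f : G →* H) : IsIso (trivialMap k M f 0) := by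
  have isIso_H0π (G : Type u) [Group G] : IsIso (H0π (Rep.trivial k G M)) := by
    rw [← H0IsoOfIsTrivial_inv_eq_π]
    infer_instance
  have := isIso_H0π G
  have h : H0π (Rep.trivial k G M) ≫ trivialMap k M f 0 = H0π (Rep.trivial k H M) :=
    (H0π_comp_map (A := Rep.trivial k G M) (B := Rep.trivial k H M) f
      (𝟙 (Rep.trivial k G M))).trans (Category.id_comp _)
  have : IsIso (H0π (Rep.trivial k G M) ≫ trivialMap k M f 0) := h ▸ isIso_H0π H
  exact IsIso.of_isIso_comp_left (H0π (Rep.trivial k G M)) _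

end Functoriality

namespace SignedWord

variable (k M : Type) [CommRing k] [AddCommGroup M] [Module k M] {n l : ℕ}

/-- The representation of `SignedPerm n` on the linear combinations of signed words of length `l`
with coefficients in `M`. -/
noncomputable abbrev rep (n l : ℕ) : Rep k (SignedPerm n) :=
  permTensor (SignedWord n l) (Rep.trivial k (SignedPerm n) M)

/-- The morphism deleting the `i`-th letter. -/
noncomputable def faceHom (n : ℕ) {l : ℕ} (i : Fin (l + 1)) : rep k M n (l + 1) ⟶ rep k M n l :=
  Rep.ofHom ⟨lmapDomain M k (face i), fun g => lhom_ext fun w c => by simp [smul_face]⟩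

theorem faceHom_single (i : Fin (l + 1)) (w : SignedWord n (l + 1)) (c : M) :
    (faceHom k M n i).hom (single w c) = single (face i w) c :=
  mapDomain_single

/-- The alternating sum of the face morphisms. -/
noncomputable def d (n l : ℕ) : rep k M n (l + 1) ⟶ rep k M n l :=
  ∑ i : Fin (l + 1), (-1 : ℤ) ^ (i : ℕ) • faceHom k M n i

theorem d_single (w : SignedWord n (l + 1)) (c : M) :
    (d k M n l).hom (single w c) = ∑ i : Fin (l + 1), (-1 : ℤ) ^ (i : ℕ) • single (face i w) c := by
  rw [d, Rep.sum_hom, Representation.IntertwiningMap.sum_apply]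
  refine Finset.sum_congr rfl fun i _ => ?_
  rw [← faceHom_single k]
  rfl

section ToWords

variable {M}

/-- The linear map sending a signed word to the underlying list. -/
noncomputable def toWords : (SignedWord n l →₀ M) →ₗ[ℤ] (List (SignedSet n) →₀ M) :=
  lmapDomain M ℤ fun w : SignedWord n l => w.1

theorem toWords_single (w : SignedWord n l) (c : M) : toWords (single w c) = single w.1 c :=
  mapDomain_single

theorem toWords_injective : Function.Injective (toWords (M := M) (n := n) (l := l)) :=
  mapDomain_injective Subtype.val_injective

theorem range_toWords : LinearMap.range (toWords (M := M) (n := n) (l := l)) =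
    supported M ℤ (WordComplex.words SignedSet.natAbs (Finset.Icc 1 n) l) := by
  rw [toWords, LinearMap.range_eq_map, ← supported_univ, lmapDomain_supported, Set.image_univ]
  congr 1
  ext w
  exact ⟨fun ⟨v, hv⟩ => hv ▸
      ⟨v.2.1, v.2.2, fun x _ => Finset.mem_Icc.2 ⟨x.natAbs_pos, x.natAbs_le⟩⟩,
    fun ⟨hlen, hnodup, _⟩ => ⟨⟨w, hlen, hnodup⟩, rfl⟩⟩

theorem toWords_d (z : rep k M n (l + 1)) :
    toWords ((d k M n l).hom z) = WordComplex.boundary (toWords z) := by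
  induction z using Finsupp.induction_linear with
  | zero => simp only [map_zero]
  | add _ _ h₁ h₂ => simp only [map_add, h₁, h₂]
  | single w c =>
    rw [d_single, toWords_single, WordComplex.boundary_single, w.2.1, Finset.sum_range, map_sum]
    refine Finset.sum_congr rfl fun i _ => ?_
    rw [map_smul, toWords_single]
    rfl

theorem exists_d_eq (hl : l < n) (z : rep k M n l) (hz : WordComplex.boundary (toWords z) = 0) :
    ∃ y, (d k M n l).hom y = z := by
  obtain ⟨y, hy, hyz⟩ := WordComplex.acyclic (M := M) SignedSet.coe_Icc_subset_range_natAbs l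
    (by simpa using hl) (toWords z) (range_toWords.le ⟨z, rfl⟩) hz
  obtain ⟨y, rfl⟩ := range_toWords.ge hy
  exact ⟨y, toWords_injective ((toWords_d k y).trans hyz)⟩

theorem boundary_toWords_of_length_zero (z : SignedWord n 0 →₀ M) :
    WordComplex.boundary (toWords z) = 0 := by
  induction z using Finsupp.induction_linear with
  | zero => simp only [map_zero]
  | add _ _ h₁ h₂ => rw [map_add, map_add, h₁, h₂, add_zero]
  | single w c =>
    rw [toWords_single, List.length_eq_zero_iff.1 w.2.1, WordComplex.boundary_single_nil]

end ToWords

theorem d_comp_d (n l : ℕ) : d k M n (l + 1) ≫ d k M n l = 0 := by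
  refine Rep.hom_ext (DFunLike.ext _ _ fun z => toWords_injective ?_)
  change toWords ((d k M n l).hom ((d k M n (l + 1)).hom z)) = toWords 0
  rw [toWords_d, toWords_d, WordComplex.boundary_boundary, map_zero]

/-- The augmented chain complex of signed words: a word of length `l` has degree `l`, so the empty
word has degree `0`. -/
noncomputable abbrev complex (n : ℕ) : ChainComplex (Rep k (SignedPerm n)) ℕ :=
  ChainComplex.of (rep k M n) (d k M n) (d_comp_d k M n)

theorem complex_d (n l : ℕ) : (complex k M n).d (l + 1) l = d k M n l :=
  ChainComplex.of_d _ _ _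

theorem exactAt_complex (hl : l < n) : (complex k M n).ExactAt l := by
  cases l with
  | zero =>
    rw [HomologicalComplex.exactAt_iff' _ 1 0 0 (by simp) (by simp), exact_iff_function_exact]
    refine fun z => ⟨fun _ => ?_, fun _ => ?_⟩
    · change ∃ y, ((complex k M n).d 1 0).hom y = z
      rw [complex_d]
      exact exists_d_eq k hl z (boundary_toWords_of_length_zero z)
    · change ((complex k M n).d 0 0).hom z = 0
      rw [(complex k M n).shape 0 0 (by simp)]
      rfl
  | succ l =>
    rw [HomologicalComplex.exactAt_iff' _ (l + 2) (l + 1) l (by simp) (by simp),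
      exact_iff_function_exact]
    change Function.Exact ((complex k M n).d (l + 2) (l + 1)).hom ((complex k M n).d (l + 1) l).hom
    rw [complex_d, complex_d]
    refine fun z => ⟨fun hz => exists_d_eq k hl z ?_, ?_⟩
    · rw [← toWords_d, hz, map_zero]
    · rintro ⟨y, rfl⟩
      exact congrArg (fun φ : rep k M n (l + 2) ⟶ rep k M n l => φ.hom y) (d_comp_d k M n l)

theorem incl_smul_std (hl : l ≤ n) {m : ℕ} (hm : m ≤ n) (hml : m + l ≤ n) (s : SignedPerm m) :
    SignedPerm.incl hm s • std hl = std hl :=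
  (smul_std_eq_iff hl _).2 fun _ hx => SignedPerm.incl_apply_of_lt _ s (by omega)

/-- The Shapiro map `H_q(SignedPerm (n - l); M) ⟶ H_q(SignedPerm n; rep n l)`. -/
noncomputable def shapiro (hl : l ≤ n) (q : ℕ) :
    groupHomology (Rep.trivial k (SignedPerm (n - l)) M) q ⟶
      (functor k (SignedPerm n) q).obj (rep k M n l) :=
  map _ ((permTensorSingle (SignedPerm.incl (Nat.sub_le n l)) (std hl) k
    (incl_smul_std hl _ (by omega))).app (Rep.trivial k (SignedPerm n) M)) q

instance isIso_shapiro (hl : l ≤ n) (q : ℕ) : IsIso (shapiro k M hl q) :=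
  isIso_map_permTensorSingle (SignedPerm.incl (Nat.sub_le n l)) (std hl)
    (SignedPerm.incl_injective _) (incl_smul_std hl _ (by omega))
    (fun g hg => SignedPerm.mem_range_incl _ ((smul_std_eq_iff hl g).1 hg))
    (fun v => (exists_smul_eq (std hl) v).imp fun _ h => h.1) q (Rep.trivial k (SignedPerm n) M)

theorem shapiro_comp_faceHom (hl : l + 1 ≤ n) (i : Fin (l + 1)) (q : ℕ) :
    shapiro k M hl q ≫ (functor k (SignedPerm n) q).map (faceHom k M n i) =
      trivialMap k M (SignedPerm.incl (Nat.sub_le (n - l) 1)) q ≫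
        shapiro k M (l.le_succ.trans hl) q := by
  obtain ⟨g, hg, hgw⟩ := exists_smul_std_eq_face hl i
  have hstd := incl_smul_std (l.le_succ.trans hl) (Nat.sub_le n (l + 1)) (by omega)
  have hface (s) :
      SignedPerm.incl (Nat.sub_le n (l + 1)) s • face i (std hl) = face i (std hl) := by
    rw [smul_face, incl_smul_std hl _ (by omega)]
  let ι := SignedPerm.incl (Nat.sub_le n (l + 1))
  let χ : Rep.trivial k (SignedPerm (n - (l + 1))) M ⟶ Rep.res ι (rep k M n l) :=
    (permTensorSingle ι _ k hstd).app (Rep.trivial k (SignedPerm n) M)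
  let χ' : Rep.trivial k (SignedPerm (n - (l + 1))) M ⟶ Rep.res ι (rep k M n l) :=
    (permTensorSingle ι _ k hface).app (Rep.trivial k (SignedPerm n) M)
  have hconj : map ι χ q ≫ map _ ((conjHom k g).app (rep k M n l)) q = map ι χ' q := by
    refine map_comp_map_of_apply (MonoidHom.ext (SignedPerm.conj_incl _ hg)) (fun c => ?_) q
    change (rep k M n l).ρ g (single (std _) c) = single (face i (std hl)) c
    rw [permTensor_ρ_single, hgw]
    rfl
  rw [map_conjHom, Category.comp_id] at hconj
  have hface_comp : shapiro k M hl q ≫ (functor k (SignedPerm n) q).map (faceHom k M n i) =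
      map ι χ' q :=
    map_comp_map_of_apply (MonoidHom.id_comp _) (faceHom_single k M i _) q
  have hincl_comp : trivialMap k M (SignedPerm.incl (Nat.sub_le (n - l) 1)) q ≫
      shapiro k M (l.le_succ.trans hl) q = map ι χ q :=
    map_comp_map_of_apply (SignedPerm.incl_comp_incl _ _) (fun _ => rfl) q
  exact hface_comp.trans (hconj.symm.trans hincl_comp.symm)

theorem shapiro_comp_d (hl : l + 1 ≤ n) (q : ℕ) :
    shapiro k M hl q ≫ (functor k (SignedPerm n) q).map (d k M n l) =
      (if Even (l + 1) then (0 : ℤ) else 1) •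
        (trivialMap k M (SignedPerm.incl (Nat.sub_le (n - l) 1)) q ≫
          shapiro k M (l.le_succ.trans hl) q) := by
  rw [d, Functor.map_sum, Preadditive.comp_sum, ← neg_one_geom_sum, Finset.sum_range,
    Finset.sum_smul]
  refine Finset.sum_congr rfl fun i _ => ?_
  rw [Functor.map_zsmul, Preadditive.comp_zsmul, shapiro_comp_faceHom]

theorem map_complex_d_eq_zero (hl : l + 1 ≤ n) (hodd : Odd l) (q : ℕ) :
    (functor k (SignedPerm n) q).map ((complex k M n).d (l + 1) l) = 0 := by
  rw [complex_d]
  have h := shapiro_comp_d k M hl q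
  rw [if_pos hodd.add_one, zero_smul] at h
  exact (cancel_epi (shapiro k M hl q)).1 (h.trans Limits.comp_zero.symm)

theorem isIso_map_complex_d_iff (hl : l + 1 ≤ n) (heven : Even l) (q : ℕ) :
    IsIso ((functor k (SignedPerm n) q).map ((complex k M n).d (l + 1) l)) ↔
      IsIso (trivialMap k M (SignedPerm.incl (Nat.sub_le (n - l) 1)) q) := by
  rw [complex_d]
  have h := shapiro_comp_d k M hl q
  rw [if_neg (by simpa [Nat.even_add_one] using heven), one_smul] at h
  rw [← isIso_comp_left_iff (shapiro k M hl q), h, isIso_comp_right_iff]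

end SignedWord

end Stabilization

theorem proposition6_general (k M : Type) [CommRing k] [AddCommGroup M] [Module k M] (n r : ℕ)
    (h : 2 * r < n) :
    CategoryTheory.IsIso (trivialMap k M
      (SignedPerm.incl (Nat.sub_le n 1) : SignedPerm (n - 1) →* SignedPerm n) r) := by
  induction r using Nat.strong_induction_on generalizing n with
  | _ r ih =>
    rcases Nat.eq_zero_or_pos r with rfl | hr
    · exact isIso_trivialMap_zero k M _
    · refine (SignedWord.isIso_map_complex_d_iff k M (l := 0) (by omega) (by simp) r).1 ?_
      refine isIso_functor_map_d_one_zero (fun i hi => SignedWord.exactAt_complex k M hi)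
        (fun i q hq hi hiq => ?_) (by omega) h
        (SignedWord.map_complex_d_eq_zero k M (by omega) (by simp) r)
      exact (SignedWord.isIso_map_complex_d_iff k M (by omega) hi q).2
        (ih q hq (n - i) (by omega))

theorem proposition6 (n r : ℕ) (h : 2 * r < n) :
    CategoryTheory.IsIso
      (integralHomologyMap
        (SignedPerm.incl (Nat.sub_le n 1) : SignedPerm (n - 1) →* SignedPerm n) r) :=
  proposition6_general ℤ ℤ n r h
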